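/- Let $A$ be a finite commutative ring (with $1$). A local rule of radius $1$ is a function $f : A^3 \to A$; it is called linear if there are $\lambda_0,\lambda_1,\lambda_2 \in A$ with $f(u_0,u_1,u_2)=\lambda_0u_0+\lambda_1u_1+\lambda_2u_2$ for all $u \in A^3$. Let $\mathcal R$ be a (necessarily finite) set of linear local rules of radius $1$. A distribution $\theta\in\Theta_{\mathcal R}=\mathcal R^{\mathbb Z}$ induces the non-uniform cellular automaton $H_\theta : A^{\mathbb Z}\to A^{\mathbb Z}$, $H_\theta(x)_i=\theta_i(x_{i-1},x_i,x_{i+1})$. Equip $A^{\mathbb Z}$ with the Cantor distance $d(x,y)=0$ if $x=y$ and otherwise $d(x,y)=2^{-k}$, $k=\min\{i\in\mathbb N : x_{[-i,i]}\ne y_{[-i,i]}\}$. The map $H_\theta$ is sensitive if $$\exists \epsilon>0,\ \forall x\in A^{\mathbb Z},\ \forall\delta>0,\ \exists y\in A^{\mathbb Z},\quad d(x,y)<\delta \ \text{ and }\ \exists n\in\mathbb N,\ d(H_\theta^n(x),H_\theta^n(y))>\epsilon .$$ A set of bi-infinite words over an alphabet is $\zeta$-rational if it is recognized by a finite automaton,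 i.e. if it is the set of labels of all bi-infinite paths of some finite (nondeterministic) automaton that visit initial states at infinitely many negative indices and final states at infinitely many positive indices. Then $\{\theta\in\Theta_{\mathcal R} : H_\theta \text{ is sensitive}\}$ is a $\zeta$-rational language over the alphabet $\mathcal R$. -/

import Mathlib

/-- Configurations over the alphabet `A`: bi-infinite sequences of letters. -/
abbrev Config (A : Type*) := ℤ → A

/-- Local rules of radius `r`: functions `A ^ (2 r + 1) → A`. -/
abbrev LocalRule (A : Type*) (r : ℕ) := (Fin (2 * r + 1) → A) → A

/-- A local rule is linear if it is a linear form `u ↦ ∑ k, c k * u k` with coefficients in the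
commutative ring `A`. -/
def LocalRule.IsLinear {A : Type*} [CommRing A] {r : ℕ} (f : LocalRule A r) : Prop :=
  ∃ c : Fin (2 * r + 1) → A, ∀ u : Fin (2 * r + 1) → A, f u = ∑ k, c k * u k

/-- Distributions on a set `R` of local rules: maps `ℤ → R`. -/
abbrev RuleDistribution {A : Type*} {r : ℕ} (R : Set (LocalRule A r)) := ℤ → R

/-- The non-uniform cellular automaton induced by a distribution of rules:
`H_θ(x)_i = θ_i (x_{i-r}, …, x_{i+r})`. -/
def inducedNUCA {A : Type*} {r : ℕ} {R : Set (LocalRule A r)} (θ : RuleDistribution R) :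
    Config A → Config A :=
  fun x i => (θ i : LocalRule A r) (fun k => x (i - (r : ℤ) + (k : ℤ)))

open Classical in
/-- The Cantor distance: `0` if `x = y`, and `2 ^ (-k)` with `k` the least natural number such that
`x` and `y` differ on `[-k, k]` otherwise. -/
noncomputable def cantorDist {A : Type*} (x y : Config A) : ℝ :=
  if x = y then 0
  else (1 / 2 : ℝ) ^ sInf {k : ℕ | ∃ j : ℤ, -(k : ℤ) ≤ j ∧ j ≤ (k : ℤ) ∧ x j ≠ y j}

/-- Sensitivity to initial conditions, for the Cantor distance. -/
def IsSensitive {A : Type*} (H : Config A → Config A) : Prop :=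
  ∃ ε : ℝ, 0 < ε ∧ ∀ x : Config A, ∀ δ : ℝ, 0 < δ →
    ∃ y : Config A, cantorDist x y < δ ∧ ∃ n : ℕ, ε < cantorDist (H^[n] x) (H^[n] y)

/-- The set of bi-infinite words recognized by a (nondeterministic) automaton: labels of bi-infinite
paths which visit initial states at infinitely many negative indices and final states at infinitely
many positive indices. -/
def zetaLanguage {α Q : Type*} (M : NFA α Q) : Set (ℤ → α) :=
  {w | ∃ p : ℤ → Q, (∀ i : ℤ, p (i + 1) ∈ M.step (p i) (w i)) ∧
    {i : ℤ | i < 0 ∧ p i ∈ M.start}.Infinite ∧ {i : ℤ | 0 < i ∧ p i ∈ M.accept}.Infinite}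

/-- A set of bi-infinite words is `ζ`-rational if it is recognized by a finite automaton. -/
def IsZetaRational {α : Type*} (L : Set (ℤ → α)) : Prop :=
  ∃ (Q : Type) (_ : Finite Q) (M : NFA α Q), L = zetaLanguage M

/-! ### Closure properties of `ζ`-rational languages -/

/-! A linear distribution induces a bi-infinite tridiagonal matrix with subdiagonal `a` and
superdiagonal `d`. A perturbation reaches cell `j` from far on the right only by crossing every cell
between, so its effect is divisible by a product `d j * d (j + 1) * ⋯`; from the left, by `a j * a
(j - 1) * ⋯`. Conversely, the fastest signal arrives with exactly this coefficient. So sensitivity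
means that, from some `j`, all these finite products on one side are nonzero
(`isSensitive_tridiag_iff`). As `A` is finite, an automaton can guess `j` and store the running
product; the left-hand condition follows by reflection, and the two are joined by a union. -/

theorem isZetaRational_zetaLanguage {α Q : Type*} [Finite Q] (M : NFA α Q) :
    IsZetaRational (zetaLanguage M) := by
  obtain ⟨n, ⟨e⟩⟩ := Finite.exists_equiv_fin Q
  refine ⟨Fin n, inferInstance,
    { step := fun q a => {q' | e.symm q' ∈ M.step (e.symm q) a}
      start := {q | e.symm q ∈ M.start}
      accept := {q | e.symm q ∈ M.accept} }, ?_⟩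
  ext w
  constructor
  · rintro ⟨p, hp, hs, ha⟩
    exact ⟨fun i => e (p i), by simpa using hp, by simpa using hs, by simpa using ha⟩
  · rintro ⟨p, hp, hs, ha⟩
    exact ⟨fun i => e.symm (p i), hp, hs, ha⟩

theorem infinite_reflect {P : ℤ → Prop} (h : {i : ℤ | 0 < i ∧ P i}.Infinite) :
    {i : ℤ | i < 0 ∧ P (1 - i)}.Infinite := by
  -- The index `1` is dropped because its reflection `0` is not negative.
  have h1 : ({i : ℤ | 0 < i ∧ P i} \ {1}).Infinite := h.sdiff (Set.finite_singleton 1)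
  refine (h1.image (f := fun i : ℤ => 1 - i) (fun a _ b _ hab => by simpa using hab)).mono ?_
  rintro _ ⟨i, ⟨⟨hi, hP⟩, hne⟩, rfl⟩
  have : i ≠ 1 := hne
  refine ⟨by lia, by simpa using hP⟩

theorem infinite_reflect' {P : ℤ → Prop} (h : {i : ℤ | i < 0 ∧ P i}.Infinite) :
    {i : ℤ | 0 < i ∧ P (1 - i)}.Infinite := by
  refine (h.image (f := fun i : ℤ => 1 - i) (fun a _ b _ hab => by simpa using hab)).mono ?_
  rintro _ ⟨i, ⟨hi, hP⟩, rfl⟩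
  refine ⟨by lia, by simpa using hP⟩

theorem reflect_mem_zetaLanguage_reverse {α Q : Type*} {M : NFA α Q} {w : ℤ → α}
    (h : w ∈ zetaLanguage M) : (fun i => w (-i)) ∈ zetaLanguage M.reverse := by
  obtain ⟨p, hp, hs, ha⟩ := h
  -- The letter `w i` sits between the states `p i` and `p (i + 1)`, so reflecting letters about `0`
  -- reflects states about `1 / 2`.
  refine ⟨fun i => p (1 - i), fun i => ?_, infinite_reflect (P := fun i => p i ∈ M.accept) ha,
    infinite_reflect' (P := fun i => p i ∈ M.start) hs⟩
  have := hp (-i)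
  have e1 : 1 - (i + 1) = -i := by ring
  have e2 : 1 - i = -i + 1 := by ring
  simp only [e1, e2]
  exact this

theorem IsZetaRational.reflect {α : Type*} {L : Set (ℤ → α)} (h : IsZetaRational L) :
    IsZetaRational {w | (fun i => w (-i)) ∈ L} := by
  obtain ⟨Q, hQ, M, rfl⟩ := h
  refine ⟨Q, hQ, M.reverse, ?_⟩
  ext w
  constructor
  · intro hw
    simpa using reflect_mem_zetaLanguage_reverse hw
  · intro hw
    simpa using reflect_mem_zetaLanguage_reverse hw

/-- The disjoint union of two nondeterministic automata. -/
def NFA.disjSum {α Q₁ Q₂ : Type*} (M₁ : NFA α Q₁) (M₂ : NFA α Q₂) : NFA α (Q₁ ⊕ Q₂) where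
  step q a := Sum.elim (fun q => Sum.inl '' M₁.step q a) (fun q => Sum.inr '' M₂.step q a) q
  start := Sum.inl '' M₁.start ∪ Sum.inr '' M₂.start
  accept := Sum.inl '' M₁.accept ∪ Sum.inr '' M₂.accept

theorem zetaLanguage_disjSum {α Q₁ Q₂ : Type*} (M₁ : NFA α Q₁) (M₂ : NFA α Q₂) :
    zetaLanguage (M₁.disjSum M₂) = zetaLanguage M₁ ∪ zetaLanguage M₂ := by
  ext w
  constructor
  · rintro ⟨p, hp, hs, ha⟩
    -- No transition joins the two summands, so a whole run stays in one of them.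
    have hstep : ∀ i, (p i).isLeft = (p (i + 1)).isLeft := by
      intro i
      have := hp i
      cases h : p i <;> simp only [h, NFA.disjSum, Sum.elim_inl, Sum.elim_inr] at this <;>
        obtain ⟨q, -, hq⟩ := this <;> simp [← hq]
    have hconst : ∀ i, (p i).isLeft = (p 0).isLeft := by
      intro i
      induction i using Int.induction_on with
      | zero => rfl
      | succ n ih => rw [← hstep, ih]
      | pred n ih => rw [hstep, sub_add_cancel, ih]
    cases h0 : p 0 with
    | inl q =>
      left
      have : ∀ i, ∃ q, p i = Sum.inl q := fun i => by
        rw [← Sum.isLeft_iff, hconst i, h0]; rfl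
      choose p' hp' using this
      refine ⟨p', fun i => ?_, ?_, ?_⟩
      · simpa [NFA.disjSum, hp'] using hp i
      · simpa [NFA.disjSum, hp'] using hs
      · simpa [NFA.disjSum, hp'] using ha
    | inr q =>
      right
      have : ∀ i, ∃ q, p i = Sum.inr q := fun i => by
        rw [← Sum.isRight_iff, ← Sum.isLeft_eq_false, hconst i, h0]; rfl
      choose p' hp' using this
      refine ⟨p', fun i => ?_, ?_, ?_⟩
      · simpa [NFA.disjSum, hp'] using hp i
      · simpa [NFA.disjSum, hp'] using hs
      · simpa [NFA.disjSum, hp'] using ha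
  · rintro (⟨p, hp, hs, ha⟩ | ⟨p, hp, hs, ha⟩)
    · exact ⟨fun i => Sum.inl (p i), by simpa [NFA.disjSum] using hp,
        by simpa [NFA.disjSum] using hs, by simpa [NFA.disjSum] using ha⟩
    · exact ⟨fun i => Sum.inr (p i), by simpa [NFA.disjSum] using hp,
        by simpa [NFA.disjSum] using hs, by simpa [NFA.disjSum] using ha⟩

theorem IsZetaRational.union {α : Type*} {L₁ L₂ : Set (ℤ → α)} (h₁ : IsZetaRational L₁)
    (h₂ : IsZetaRational L₂) : IsZetaRational (L₁ ∪ L₂) := by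
  obtain ⟨Q₁, _, M₁, rfl⟩ := h₁
  obtain ⟨Q₂, _, M₂, rfl⟩ := h₂
  exact ⟨Q₁ ⊕ Q₂, inferInstance, M₁.disjSum M₂, (zetaLanguage_disjSum M₁ M₂).symm⟩

/-! ### Words with nonvanishing products -/

/-- The automaton which waits in the state `none`, then starts multiplying the weights of the
letters, and gets stuck when the product vanishes. -/
def productNFA {α A : Type*} [CommRing A] (g : α → A) : NFA α (Option A) where
  step q a := q.elim {none, some 1} (fun b => {q' | b * g a ≠ 0 ∧ q' = some (b * g a)})
  start := {none}
  accept := {none}ᶜ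

/-- The two acceptance conditions force the run to leave `none`, which it can do only through `some
1`; the time of this jump is `j`. -/
theorem zetaLanguage_productNFA {α A : Type*} [CommRing A] (g : α → A) :
    zetaLanguage (productNFA g) =
      {w | ∃ j : ℤ, ∀ n : ℕ, ∏ k ∈ Finset.range n, g (w (j + k)) ≠ 0} := by
  ext w
  constructor
  · rintro ⟨p, hp, hs, ha⟩
    obtain ⟨i₀, hi₀, hp₀⟩ := hs.nonempty
    obtain ⟨i₁, hi₁, hp₁⟩ := ha.nonempty
    have hp₀ : p i₀ = none := hp₀
    have hp₁ : p i₁ ≠ none := hp₁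
    obtain ⟨j, hj⟩ : ∃ j, p j = some 1 := by
      by_contra! hcon
      refine hp₁ (Int.leInduction (m := i₀) (motive := fun i _ => p i = none) hp₀ ?_ i₁
        (by lia))
      intro i _ hi
      have := hp i
      simp only [hi, productNFA, Option.elim_none, Set.mem_insert_iff,
        Set.mem_singleton_iff] at this
      exact this.resolve_right (hcon _)
    have key : ∀ n : ℕ, p (j + n) = some (∏ k ∈ Finset.range n, g (w (j + k))) ∧
        ∏ k ∈ Finset.range (n + 1), g (w (j + k)) ≠ 0 := by
      intro n
      have hmul : ∀ n : ℕ, p (j + n) = some (∏ k ∈ Finset.range n, g (w (j + k))) →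
          ∏ k ∈ Finset.range (n + 1), g (w (j + k)) ≠ 0 ∧
          p (j + n + 1) = some (∏ k ∈ Finset.range (n + 1), g (w (j + k))) := by
        intro n hn
        have := hp (j + n)
        rw [hn] at this
        rw [Finset.prod_range_succ]
        exact this
      induction n with
      | zero => exact ⟨by simpa using hj, (hmul 0 (by simpa using hj)).1⟩
      | succ n ih =>
        have h := (hmul n ih.1).2
        rw [add_assoc, ← Nat.cast_succ] at h
        exact ⟨h, (hmul (n + 1) h).1⟩
    -- The jump to `some 1` does not test `1 ≠ 0`, so the empty product is handled through the next
    -- one.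
    refine ⟨j, fun n h => (key n).2 ?_⟩
    rw [Finset.prod_range_succ, h, zero_mul]
  · rintro ⟨j, hj⟩
    refine ⟨fun i => if i < j then none
      else some (∏ k ∈ Finset.range (i - j).toNat, g (w (j + k))), fun i => ?_, ?_, ?_⟩
    · rcases lt_trichotomy (i + 1) j with h | h | h
      · simp [productNFA, h, (by lia : i < j)]
      · simp [productNFA, h, (by lia : i < j)]
      · obtain ⟨n, rfl⟩ := Int.exists_add_of_le (by lia : j ≤ i)
        have e1 : (j + (n : ℤ) - j).toNat = n := by lia
        have e2 : (j + (n : ℤ) + 1 - j).toNat = n + 1 := by lia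
        have h1 : ¬ (j + (n : ℤ) < j) := by lia
        have h2 : ¬ (j + (n : ℤ) + 1 < j) := by lia
        have h3 := hj (n + 1)
        simp only [h1, h2, if_false, e1, e2, productNFA, Option.elim_some]
        rw [Finset.prod_range_succ] at h3 ⊢
        exact ⟨h3, rfl⟩
    · refine (Set.Iio_infinite (min j 0)).mono fun i hi => ?_
      have hi : i < min j 0 := hi
      exact ⟨by lia, by simp [productNFA, (by lia : i < j)]⟩
    · refine (Set.Ioi_infinite (max j 0)).mono fun i hi => ?_
      have hi : max j 0 < i := hi
      exact ⟨by lia, by simp [productNFA, (by lia : ¬ i < j)]⟩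

theorem isZetaRational_prod_right {α A : Type*} [CommRing A] [Finite A] (g : α → A) :
    IsZetaRational {w : ℤ → α | ∃ j : ℤ, ∀ n : ℕ, ∏ k ∈ Finset.range n, g (w (j + k)) ≠ 0} := by
  rw [← zetaLanguage_productNFA]
  exact isZetaRational_zetaLanguage _

theorem isZetaRational_prod_left {α A : Type*} [CommRing A] [Finite A] (g : α → A) :
    IsZetaRational {w : ℤ → α | ∃ j : ℤ, ∀ n : ℕ, ∏ k ∈ Finset.range n, g (w (j - k)) ≠ 0} := by
  convert (isZetaRational_prod_right g).reflect using 1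
  ext w
  simp only [Set.mem_ofPred_eq]
  rw [← (Equiv.neg ℤ).exists_congr_right]
  simp only [Equiv.neg_apply, neg_add, sub_eq_add_neg]

/-! ### The Cantor distance -/

theorem cantorDist_le {A : Type*} {x y : Config A} {M : ℕ}
    (h : ∀ j : ℤ, -(M : ℤ) ≤ j → j ≤ M → x j = y j) : cantorDist x y ≤ (1 / 2 : ℝ) ^ M := by
  unfold cantorDist
  split_ifs with hxy
  · positivity
  · refine pow_le_pow_of_le_one (by norm_num) (by norm_num) ?_
    obtain ⟨i, hi⟩ := Function.ne_iff.mp hxy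
    refine le_csInf ⟨i.natAbs, i, by lia, by lia, hi⟩ ?_
    rintro k ⟨j, hj1, hj2, hj⟩
    by_contra! hk
    exact hj (h j (by lia) (by lia))

theorem le_cantorDist {A : Type*} {x y : Config A} {M : ℕ} {j : ℤ} (h1 : -(M : ℤ) ≤ j)
    (h2 : j ≤ M) (h : x j ≠ y j) : (1 / 2 : ℝ) ^ M ≤ cantorDist x y := by
  unfold cantorDist
  rw [if_neg fun hxy => h (congrFun hxy j)]
  exact pow_le_pow_of_le_one (by norm_num) (by norm_num) (Nat.sInf_le ⟨j, h1, h2, h⟩)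

/-! ### Tridiagonal maps -/

/-- The linear map on configurations given by the bi-infinite tridiagonal matrix with
subdiagonal `a`, diagonal `b` and superdiagonal `d`. -/
def tridiag {A : Type*} [CommRing A] (a b d : ℤ → A) : Module.End A (Config A) where
  toFun x i := a i * x (i - 1) + b i * x i + d i * x (i + 1)
  map_add' x y := by ext i; simp only [Pi.add_apply]; ring
  map_smul' c x := by ext i; simp only [Pi.smul_apply, smul_eq_mul, RingHom.id_apply]; ring

section Tridiagonal

variable {A : Type*} [CommRing A] (a b d : ℤ → A)

theorem tridiag_pow_succ_apply (n : ℕ) (x : Config A) (i : ℤ) :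
    (tridiag a b d ^ (n + 1)) x i = a i * (tridiag a b d ^ n) x (i - 1) +
      b i * (tridiag a b d ^ n) x i + d i * (tridiag a b d ^ n) x (i + 1) := by
  rw [pow_succ']
  rfl

/-- The only path of `n` steps from `[j + n, ∞)` to `j` moves left each time: in the induction, the
neighbours `j - 1` and `j` still see only zeros. -/
theorem tridiag_pow_apply_of_right {n : ℕ} {x : Config A} {j : ℤ}
    (hx : ∀ k < j + n, x k = 0) :
    (tridiag a b d ^ n) x j = (∏ k ∈ Finset.range n, d (j + k)) * x (j + n) := by
  induction n generalizing j with
  | zero => simp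
  | succ n ih =>
    push_cast at hx
    rw [tridiag_pow_succ_apply, ih fun k hk => hx k (by lia), ih fun k hk => hx k (by lia),
      ih fun k hk => hx k (by lia), hx (j - 1 + n) (by lia), hx (j + n) (by lia),
      Finset.prod_range_succ']
    have e : ∀ k : ℕ, j + 1 + (k : ℤ) = j + ((k + 1 : ℕ) : ℤ) := fun k => by push_cast; ring
    simp only [e, Nat.cast_zero, add_zero]
    ring

theorem tridiag_pow_apply_of_left {n : ℕ} {x : Config A} {j : ℤ}
    (hx : ∀ k > j - n, x k = 0) :
    (tridiag a b d ^ n) x j = (∏ k ∈ Finset.range n, a (j - k)) * x (j - n) := by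
  induction n generalizing j with
  | zero => simp
  | succ n ih =>
    push_cast at hx
    rw [tridiag_pow_succ_apply, ih fun k hk => hx k (by lia), ih fun k hk => hx k (by lia),
      ih fun k hk => hx k (by lia), hx (j + 1 - n) (by lia), hx (j - n) (by lia),
      Finset.prod_range_succ']
    have e : ∀ k : ℕ, j - 1 - (k : ℤ) = j - ((k + 1 : ℕ) : ℤ) := fun k => by push_cast; ring
    simp only [e, Nat.cast_zero, sub_zero]
    ring

/-- Information coming from outside `[l, r]` has to cross every cell in between, hence is
divisible by the product of the corresponding coefficients. -/
theorem tridiag_pow_apply_mem_span {x : Config A} {l r : ℤ}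
    (hx : ∀ k, l ≤ k → k ≤ r → x k = 0) (n : ℕ) (j : ℤ) :
    (tridiag a b d ^ n) x j ∈
      Ideal.span {∏ k ∈ Finset.Icc j r, d k, ∏ k ∈ Finset.Icc l j, a k} := by
  induction n generalizing j with
  | zero =>
    rcases lt_or_ge j l with h | h
    · simp [Finset.Icc_eq_empty (not_le.mpr h), Ideal.span_insert, Ideal.span_singleton_one]
    rcases lt_or_ge r j with h' | h'
    · simp [Finset.Icc_eq_empty (not_le.mpr h'), Ideal.span_insert, Ideal.span_singleton_one]
    simp [hx j h h']
  | succ n ih =>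
    rcases lt_or_ge j l with h | h
    · simp [Finset.Icc_eq_empty (not_le.mpr h), Ideal.span_insert, Ideal.span_singleton_one]
    rcases lt_or_ge r j with h' | h'
    · simp [Finset.Icc_eq_empty (not_le.mpr h'), Ideal.span_insert, Ideal.span_singleton_one]
    obtain ⟨u, v, h1⟩ := Ideal.mem_span_pair.mp (ih (j - 1))
    obtain ⟨u', v', h2⟩ := Ideal.mem_span_pair.mp (ih (j + 1))
    have er : ∀ j, j ≤ r → ∏ k ∈ Finset.Icc j r, d k =
        d j * ∏ k ∈ Finset.Icc (j + 1) r, d k := fun j hj => by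
      rw [← Finset.insert_Icc_add_one_left_eq_Icc hj, Finset.prod_insert (by simp)]
    have el : ∀ j, l ≤ j → ∏ k ∈ Finset.Icc l j, a k =
        a j * ∏ k ∈ Finset.Icc l (j - 1), a k := fun j hj => by
      rw [← Finset.insert_Icc_sub_one_right_eq_Icc hj, Finset.prod_insert (by simp)]
    rw [tridiag_pow_succ_apply]
    refine Ideal.add_mem _ (Ideal.add_mem _ ?_ (Ideal.mul_mem_left _ _ (ih j))) ?_
    -- Moving from `j - 1` to `j`, the factor `a j` extends the left product, while the right
    -- product at `j - 1` is already a multiple of the one at `j`.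
    · rw [← h1, er (j - 1) (by lia), sub_add_cancel, el j h]
      exact Ideal.mem_span_pair.mpr ⟨a j * u * d (j - 1), v, by ring⟩
    · rw [← h2, el (j + 1) (by lia), add_sub_cancel_right]
      exact Ideal.mem_span_pair.mpr ⟨u', d j * v' * a (j + 1), by rw [er j h']; ring⟩

theorem prod_Icc_eq_zero_of_right {j r : ℤ} {n : ℕ} (h : ∏ k ∈ Finset.range n, d (j + k) = 0)
    (hr : j + n ≤ r) : ∏ k ∈ Finset.Icc j r, d k = 0 := by
  rw [← Finset.prod_image (s := Finset.range n) (g := fun k : ℕ => j + (k : ℤ)) (f := d)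
    (fun k _ k' _ hk => by simpa using hk)] at h
  refine zero_dvd_iff.mp (h ▸ Finset.prod_dvd_prod_of_subset _ _ _ fun i hi => ?_)
  obtain ⟨k, hk, rfl⟩ := Finset.mem_image.mp hi
  have := Finset.mem_range.mp hk
  exact Finset.mem_Icc.mpr ⟨by lia, by lia⟩

theorem prod_Icc_eq_zero_of_left {j l : ℤ} {n : ℕ} (h : ∏ k ∈ Finset.range n, a (j - k) = 0)
    (hl : l ≤ j - n) : ∏ k ∈ Finset.Icc l j, a k = 0 := by
  rw [← Finset.prod_image (s := Finset.range n) (g := fun k : ℕ => j - (k : ℤ)) (f := a)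
    (fun k _ k' _ hk => by simpa using hk)] at h
  refine zero_dvd_iff.mp (h ▸ Finset.prod_dvd_prod_of_subset _ _ _ fun i hi => ?_)
  obtain ⟨k, hk, rfl⟩ := Finset.mem_image.mp hi
  have := Finset.mem_range.mp hk
  exact Finset.mem_Icc.mpr ⟨by lia, by lia⟩

/-- A linear map on configurations is sensitive if some cell is reached by perturbations
supported on single cells arbitrarily far away. -/
theorem isSensitive_of_single (T : Module.End A (Config A)) (j : ℤ)
    (h : ∀ M : ℕ, ∃ i : ℤ, M < i.natAbs ∧ ∃ n : ℕ, (T ^ n) (Pi.single i 1) j ≠ 0) :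
    IsSensitive T := by
  -- A difference at `j` gives distance at least `(1 / 2) ^ |j|`; the extra `1` makes the inequality
  -- strict.
  refine ⟨(1 / 2 : ℝ) ^ (j.natAbs + 1), by positivity, fun x δ hδ => ?_⟩
  obtain ⟨M, hM⟩ := exists_pow_lt_of_lt_one hδ (by norm_num : (1 / 2 : ℝ) < 1)
  obtain ⟨i, hi, n, hn⟩ := h M
  refine ⟨x + Pi.single i 1, (cantorDist_le fun k hk1 hk2 => ?_).trans_lt hM, n, ?_⟩
  · simp [Pi.single_eq_of_ne (by lia : k ≠ i)]
  · rw [← Module.End.coe_pow]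
    refine lt_of_lt_of_le (pow_lt_pow_right_of_lt_one₀ (by norm_num) (by norm_num)
      (Nat.lt_succ_self _)) (le_cantorDist (j := j) (by lia) (by lia) ?_)
    simpa using hn

theorem isSensitive_tridiag_iff :
    IsSensitive (tridiag a b d) ↔
      (∃ j : ℤ, ∀ n : ℕ, ∏ k ∈ Finset.range n, d (j + k) ≠ 0) ∨
      (∃ j : ℤ, ∀ n : ℕ, ∏ k ∈ Finset.range n, a (j - k) ≠ 0) := by
  constructor
  · rintro ⟨ε, hε, h⟩
    by_contra! hcon
    obtain ⟨hd, ha⟩ := hcon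
    obtain ⟨K, hK⟩ := exists_pow_lt_of_lt_one hε (by norm_num : (1 / 2 : ℝ) < 1)
    choose nd hnd using hd
    choose na hna using ha
    -- For every `j` in the finite window, both products vanish before leaving `[-M, M]`, so
    -- perturbations of `0` outside `[-M, M]` never enter the window.
    obtain ⟨M, hM⟩ : ∃ M : ℕ, ∀ j ∈ Finset.Icc (-(K : ℤ)) K,
        j + nd j ≤ M ∧ -(M : ℤ) ≤ j - na j := by
      have hev : ∀ᶠ M : ℕ in Filter.atTop, ∀ j ∈ Finset.Icc (-(K : ℤ)) K,
          j + nd j ≤ M ∧ -(M : ℤ) ≤ j - na j := by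
        rw [Filter.eventually_all_finset]
        intro j _
        filter_upwards [Filter.eventually_ge_atTop (j.natAbs + nd j + na j)] with M hM
        constructor <;> lia
      exact hev.exists
    obtain ⟨y, hy, n, hn⟩ := h 0 ((1 / 2) ^ M) (by positivity)
    have hy0 : ∀ k, -(M : ℤ) ≤ k → k ≤ M → y k = 0 := by
      intro k hk1 hk2
      by_contra hne
      exact hy.not_ge (le_cantorDist hk1 hk2 (Ne.symm hne))
    refine (hK.trans hn).not_ge (cantorDist_le fun j hj1 hj2 => ?_)
    obtain ⟨h1, h2⟩ := hM j (Finset.mem_Icc.mpr ⟨hj1, hj2⟩)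
    have hmem := tridiag_pow_apply_mem_span a b d hy0 n j
    rw [prod_Icc_eq_zero_of_right d (hnd j) h1, prod_Icc_eq_zero_of_left a (hna j) h2] at hmem
    rw [← Module.End.coe_pow, map_zero]
    simpa [eq_comm] using hmem
  · rintro (⟨j, hj⟩ | ⟨j, hj⟩)
    · refine isSensitive_of_single _ j fun M => ?_
      -- The summand `|j|` compensates for a negative `j`, keeping the source beyond `M`.
      refine ⟨j + (j.natAbs + M + 1 : ℕ), by lia, j.natAbs + M + 1, ?_⟩
      rw [tridiag_pow_apply_of_right a b d fun k hk => Pi.single_eq_of_ne (by lia) _]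
      simpa using hj (j.natAbs + M + 1)
    · refine isSensitive_of_single _ j fun M => ?_
      refine ⟨j - (j.natAbs + M + 1 : ℕ), by lia, j.natAbs + M + 1, ?_⟩
      rw [tridiag_pow_apply_of_left a b d fun k hk => Pi.single_eq_of_ne (by lia) _]
      simpa using hj (j.natAbs + M + 1)

end Tridiagonal

theorem mainTheorem6 {A : Type*} [CommRing A] [Finite A] (R : Set (LocalRule A 1))
    (hlin : ∀ f ∈ R, f.IsLinear) :
    IsZetaRational {θ : RuleDistribution R | IsSensitive (inducedNUCA θ)} := by
  choose c hc using fun f : R => hlin f f.2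
  have key : ∀ θ : RuleDistribution R, inducedNUCA θ =
      tridiag (fun i => c (θ i) 0) (fun i => c (θ i) 1) (fun i => c (θ i) 2) := by
    intro θ
    ext x i
    simp only [inducedNUCA, hc, tridiag, LinearMap.coe_mk, AddHom.coe_mk]
    rw [Fin.sum_univ_three]
    norm_num
    simp [sub_add_eq_add_sub, add_sub_assoc]
  simp only [key, isSensitive_tridiag_iff]
  exact (isZetaRational_prod_right fun f : R => c f 2).union
    (isZetaRational_prod_left fun f : R => c f 0)
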